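/- Let $\mathrm{Prop}$ be a countably infinite set of propositional atoms and let the modal formulae be generated by $$\varphi ::= p \mid \neg p \mid \varphi\lor\varphi \mid \varphi\land\varphi \mid \Diamond\varphi \mid \Box\varphi \qquad (p\in\mathrm{Prop}).$$ For a binary relation $R$ on a set $W$ let $R^0$ be equality and $R^{\ell+1}(x,y) :\Leftrightarrow \exists z\,(R^{\ell}(x,z)\land R(z,y))$. A *quasi-density property* is a condition $\forall x,y\,(R^k(x,y)\to R^n(x,y))$ with $0<k<n$; it is the first-order frame condition of the axiom $\Diamond^k p\to\Diamond^n p$. For a finite set $\mathcal P$ of quasi-density properties, a $\mathcal P$-model is a triple $(W,R,V)$ with $W\neq\emptyset$, $R\subseteq W\times W$ satisfying every property in $\mathcal P$, and $V:\mathrm{Prop}\to 2^W$. Let $\mathsf L(\mathcal P)$ be the set of modal formulae that are true, under the usual Kripke semantics, at every world of every $\mathcal P$-model. **Theorem 2.3.** For every finite set $\mathcal P$ of quasi-density properties it is decidable whether a modal formula $\varphi$ belongs to $\mathsf L(\mathcal P)$. Moreover, this is uniform in $\mathcal P$: there is a computable function $f$ such that for every finite set $\mathcal P$ of quasi-density properties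 (given as a list of pairs $(k,n)$) and every modal formula $\varphi$, $f(\mathcal P,\varphi)=1$ if $\varphi\in\mathsf L(\mathcal P)$ and $f(\mathcal P,\varphi)=0$ if $\varphi\notin\mathsf L(\mathcal P)$. -/

import Mathlib

namespace QuasiDense

/-- Modal formulae in negation normal form; the propositional atoms are indexed by `ℕ`. -/
inductive Formula : Type
  | atom (p : ℕ) : Formula
  | natom (p : ℕ) : Formula
  | or (φ ψ : Formula) : Formula
  | and (φ ψ : Formula) : Formula
  | dia (φ : Formula) : Formula
  | box (φ : Formula) : Formula

/-- The `ℓ`-fold composition of a relation: `R⁰` is equality and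
`R^(ℓ+1)(x,y)` means that `R^ℓ(x,z)` and `R(z,y)` for some `z`. -/
def relPow {W : Type} (R : W → W → Prop) : ℕ → W → W → Prop
  | 0 => fun x y => x = y
  | l + 1 => fun x y => ∃ z, relPow R l x z ∧ R z y

/-- Quasi-density properties, given by the pair of exponents `(k, n)` with `0 < k < n`. -/
abbrev QDP : Type := {p : ℕ × ℕ // 0 < p.1 ∧ p.1 < p.2}

/-- The relation `R` satisfies `∀ x y, R^k(x,y) → R^n(x,y)`. -/
def QDP.Holds (p : QDP) {W : Type} (R : W → W → Prop) : Prop :=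
  ∀ x y, relPow R p.1.1 x y → relPow R p.1.2 x y

/-- Frames: a non-empty set of worlds with an accessibility relation satisfying all of `P`. -/
structure Frame (P : Finset QDP) where
  World : Type
  nonempty : Nonempty World
  rel : World → World → Prop
  holds : ∀ p ∈ P, p.Holds rel

/-- Models: frames with a valuation of the propositional atoms. -/
structure Model (P : Finset QDP) extends Frame P where
  val : ℕ → Set World

/-- The forcing relation `M, w ⊩ φ`. -/
def Model.Forces {P : Finset QDP} (M : Model P) : M.World → Formula → Prop
  | w, .atom p => w ∈ M.val p
  | w, .natom p => w ∉ M.val p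
  | w, .or φ ψ => M.Forces w φ ∨ M.Forces w ψ
  | w, .and φ ψ => M.Forces w φ ∧ M.Forces w ψ
  | w, .dia φ => ∃ u, M.rel w u ∧ M.Forces u φ
  | w, .box φ => ∀ u, M.rel w u → M.Forces u φ

/-- The logic `L(P)`: the set of formulae forced at every world of every model over a
frame satisfying `P`. -/
def Logic (P : Finset QDP) : Set Formula :=
  {φ | ∀ (M : Model P) (w : M.World), M.Forces w φ}

/-- The Gödel numbering of formulae. -/
def Formula.code : Formula → ℕ
  | .atom p => 6 * p
  | .natom p => 6 * p + 1
  | .or φ ψ => 6 * Nat.pair φ.code ψ.code + 2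
  | .and φ ψ => 6 * Nat.pair φ.code ψ.code + 3
  | .dia φ => 6 * φ.code + 4
  | .box φ => 6 * φ.code + 5

theorem Formula.code_injective : Function.Injective Formula.code := by
  intro φ
  induction φ with
  | atom p => intro χ h; cases χ <;> simp only [Formula.code] at h <;> first | omega | (congr 1; omega)
  | natom p => intro χ h; cases χ <;> simp only [Formula.code] at h <;> first | omega | (congr 1; omega)
  | or φ ψ h1 h2 =>
    intro χ h
    cases χ <;> simp only [Formula.code] at h <;> try omega
    rename_i φ' ψ'
    have e : Nat.pair φ.code ψ.code = Nat.pair φ'.code ψ'.code := by omega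
    obtain ⟨ha, hb⟩ := Nat.pair_eq_pair.1 e
    rw [h1 ha, h2 hb]
  | and φ ψ h1 h2 =>
    intro χ h
    cases χ <;> simp only [Formula.code] at h <;> try omega
    rename_i φ' ψ'
    have e : Nat.pair φ.code ψ.code = Nat.pair φ'.code ψ'.code := by omega
    obtain ⟨ha, hb⟩ := Nat.pair_eq_pair.1 e
    rw [h1 ha, h2 hb]
  | dia φ h1 =>
    intro χ h
    cases χ <;> simp only [Formula.code] at h <;> try omega
    rename_i φ'
    have e : φ.code = φ'.code := by omega
    rw [h1 e]
  | box φ h1 =>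
    intro χ h
    cases χ <;> simp only [Formula.code] at h <;> try omega
    rename_i φ'
    have e : φ.code = φ'.code := by omega
    rw [h1 e]

theorem Formula.code_surjective : Function.Surjective Formula.code := by
  intro n
  induction n using Nat.strong_induction_on with
  | _ n ih =>
    have hl := Nat.unpair_left_le (n / 6)
    have hr := Nat.unpair_right_le (n / 6)
    have hp := Nat.pair_unpair (n / 6)
    have h6 : n % 6 = 0 ∨ n % 6 = 1 ∨ n % 6 = 2 ∨ n % 6 = 3 ∨ n % 6 = 4 ∨ n % 6 = 5 := by omega
    rcases h6 with h | h | h | h | h | h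
    · exact ⟨.atom (n / 6), by simp only [Formula.code]; omega⟩
    · exact ⟨.natom (n / 6), by simp only [Formula.code]; omega⟩
    · obtain ⟨φ, hφ⟩ := ih (n / 6).unpair.1 (by omega)
      obtain ⟨ψ, hψ⟩ := ih (n / 6).unpair.2 (by omega)
      exact ⟨.or φ ψ, by simp only [Formula.code, hφ, hψ, hp]; omega⟩
    · obtain ⟨φ, hφ⟩ := ih (n / 6).unpair.1 (by omega)
      obtain ⟨ψ, hψ⟩ := ih (n / 6).unpair.2 (by omega)
      exact ⟨.and φ ψ, by simp only [Formula.code, hφ, hψ, hp]; omega⟩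
    · obtain ⟨φ, hφ⟩ := ih (n / 6) (by omega)
      exact ⟨.dia φ, by simp only [Formula.code, hφ]; omega⟩
    · obtain ⟨φ, hφ⟩ := ih (n / 6) (by omega)
      exact ⟨.box φ, by simp only [Formula.code, hφ]; omega⟩

noncomputable instance : Primcodable Formula :=
  Primcodable.ofEquiv ℕ
    (Equiv.ofBijective Formula.code ⟨Formula.code_injective, Formula.code_surjective⟩)

theorem primrecPred_qdp : PrimrecPred fun p : ℕ × ℕ => 0 < p.1 ∧ p.1 < p.2 :=
  (Primrec.nat_lt.comp (Primrec.const 0) Primrec.fst).and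
    (Primrec.nat_lt.comp Primrec.fst Primrec.snd)

instance : Primcodable QDP := Primcodable.subtype primrecPred_qdp

end QuasiDense

namespace QuasiDense

/-! The logic has a finite model property with a computable bound depending on the formula alone.
Let the atoms of `φ` lie below `A` and its depth below `D`. Worlds of a countermodel are compared by
bounded bisimilarity, which has finitely many classes at each depth (`bisimBound`). The finite model
has levels `0, ..., D`; a node at level `i` represents a world up to bisimilarity of depth `D - i`.
An edge may go up at most one level, or stay, or go down to any level. Below level `D - 1` its
target must match a genuine successor to the precision left after one step; from level `D - 1` on,
edges are otherwise unconstrained.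

Quasi-density survives (`Layering.holds_rel`). If a `k`-path starts low enough, it projects to the
original model, where it is replaced by an `n`-path. This lifts back by climbing one level per step,
and the last edge can drop onto the original endpoint: since `k < n`, the precision required there
is no more than what is known. Otherwise a `k`-path reaches level `D`, where free loops pad the
length and a free edge leads to the endpoint. Truth of `φ` at level `0` is preserved
(`Layering.forces_toModel_iff`).

Decidability follows by exhaustive search through models coded as bit masks (`not_mem_logic_iff`),
with every check primitive recursive. -/

/-- The modal depth of a formula. -/
def Formula.depth : Formula → ℕ
  | .atom _ => 0
  | .natom _ => 0
  | .or φ ψ => max φ.depth ψ.depth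
  | .and φ ψ => max φ.depth ψ.depth
  | .dia φ => φ.depth + 1
  | .box φ => φ.depth + 1

/-- All atoms of the formula are smaller than `A`. -/
def Formula.AtomsBelow (A : ℕ) : Formula → Prop
  | .atom p => p < A
  | .natom p => p < A
  | .or φ ψ => φ.AtomsBelow A ∧ ψ.AtomsBelow A
  | .and φ ψ => φ.AtomsBelow A ∧ ψ.AtomsBelow A
  | .dia φ => φ.AtomsBelow A
  | .box φ => φ.AtomsBelow A

/-- Together with `atomsBelow_of_code_lt`, this lets the code serve as the only size parameter of
the search. -/
theorem Formula.depth_le_code (φ : Formula) : φ.depth ≤ φ.code := by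
  induction φ with
  | atom p => simp [depth]
  | natom p => simp [depth]
  | or φ ψ h1 h2 | and φ ψ h1 h2 =>
    have := Nat.left_le_pair φ.code ψ.code
    have := Nat.right_le_pair φ.code ψ.code
    simp only [depth, code]
    omega
  | dia φ h | box φ h => simp only [depth, code]; omega

theorem Formula.atomsBelow_of_code_lt {A : ℕ} {φ : Formula} (h : φ.code < A) :
    φ.AtomsBelow A := by
  induction φ with
  | atom p | natom p => simp only [AtomsBelow, code] at h ⊢; omega
  | or φ ψ h1 h2 | and φ ψ h1 h2 =>
    have := Nat.left_le_pair φ.code ψ.code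
    have := Nat.right_le_pair φ.code ψ.code
    simp only [code] at h
    exact ⟨h1 (by omega), h2 (by omega)⟩
  | dia φ ih | box φ ih => simp only [code] at h; exact ih (by omega)

/-! ### Bounded bisimilarity through numerical codes -/

/-- A strict bound on the codes of worlds up to `j`-bisimilarity over `A` atoms. -/
def bisimBound (A : ℕ) : ℕ → ℕ
  | 0 => 1
  | j + 1 => 2 ^ (A + bisimBound A j)

theorem bisimBound_mono (A : ℕ) : Monotone (bisimBound A) := by
  refine monotone_nat_of_le_succ fun j => ?_
  have : A + bisimBound A j < 2 ^ (A + bisimBound A j) := Nat.lt_two_pow_self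
  simp only [bisimBound]
  omega

theorem bisimBound_pos (A j : ℕ) : 0 < bisimBound A j :=
  Nat.lt_of_lt_of_le Nat.zero_lt_one (bisimBound_mono A (Nat.zero_le j))

section Bisim

variable {P : Finset QDP} (M : Model P) (A : ℕ)

open Classical in
/-- The code of a world up to agreement on formulae of depth less than `j` over the atoms
below `A`: a bit mask recording the true atoms and the codes of the successors. -/
noncomputable def Model.bisimCode : ℕ → M.World → ℕ
  | 0, _ => 0
  | j + 1, x => Nat.ofBits (n := A + bisimBound A j) fun i =>
      decide ((i.1 < A ∧ x ∈ M.val i) ∨ ∃ y, M.rel x y ∧ i.1 = A + Model.bisimCode j y)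

theorem Model.bisimCode_lt (j : ℕ) (x : M.World) : M.bisimCode A j x < bisimBound A j := by
  cases j with
  | zero => simp [bisimCode, bisimBound]
  | succ j => exact Nat.ofBits_lt_two_pow _

variable {M A}

/-- Atom bits sit below `A` and successor bits from `A` on, so the mask decodes into the usual
back-and-forth condition. -/
theorem Model.bisimCode_succ_eq_iff {j : ℕ} {x y : M.World} :
    M.bisimCode A (j + 1) x = M.bisimCode A (j + 1) y ↔
      (∀ p < A, x ∈ M.val p ↔ y ∈ M.val p) ∧
        ∀ c, (∃ z, M.rel x z ∧ M.bisimCode A j z = c) ↔ ∃ z, M.rel y z ∧ M.bisimCode A j z = c := by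
  constructor
  · intro h
    have key : ∀ i < A + bisimBound A j,
        (((i < A ∧ x ∈ M.val i) ∨ ∃ z, M.rel x z ∧ i = A + M.bisimCode A j z) ↔
          ((i < A ∧ y ∈ M.val i) ∨ ∃ z, M.rel y z ∧ i = A + M.bisimCode A j z)) := by
      intro i hi
      have := congrArg (fun n => n.testBit i) h
      simpa [bisimCode, Nat.testBit_ofBits_lt _ _ hi] using this
    refine ⟨fun p hp => ?_, fun c => ?_⟩
    · have := key p (by omega)
      have hne : ∀ z, p ≠ A + M.bisimCode A j z := fun z => by omega
      simpa [hp, hne] using this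
    · by_cases hc : c < bisimBound A j
      · have := key (A + c) (by omega)
        simpa [eq_comm] using this
      · have hne : ∀ z, M.bisimCode A j z ≠ c := fun z hz =>
          hc (hz ▸ M.bisimCode_lt A j z)
        simp [hne]
  · rintro ⟨h1, h2⟩
    simp only [bisimCode]
    congr 1
    funext i
    rw [decide_eq_decide]
    refine or_congr (and_congr_right fun hi => h1 _ hi) ?_
    have aux : ∀ c, i.1 = A + c ↔ A ≤ i.1 ∧ c = i.1 - A := fun c => by omega
    simp only [aux]
    have := h2 (i.1 - A)
    constructor
    · rintro ⟨z, hz, hA, e⟩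
      obtain ⟨z', hz', e'⟩ := this.1 ⟨z, hz, e⟩
      exact ⟨z', hz', hA, e'⟩
    · rintro ⟨z, hz, hA, e⟩
      obtain ⟨z', hz', e'⟩ := this.2 ⟨z, hz, e⟩
      exact ⟨z', hz', hA, e'⟩

theorem Model.exists_rel_of_bisimCode_eq {j : ℕ} {x y x' : M.World}
    (h : M.bisimCode A (j + 1) x = M.bisimCode A (j + 1) y) (hx : M.rel x x') :
    ∃ y', M.rel y y' ∧ M.bisimCode A j y' = M.bisimCode A j x' :=
  ((bisimCode_succ_eq_iff.1 h).2 _).1 ⟨x', hx, rfl⟩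

theorem Model.bisimCode_eq_of_succ {j : ℕ} : ∀ {x y : M.World},
    M.bisimCode A (j + 1) x = M.bisimCode A (j + 1) y →
      M.bisimCode A j x = M.bisimCode A j y := by
  induction j with
  | zero => intros; rfl
  | succ j ih =>
    intro x y h
    refine bisimCode_succ_eq_iff.2 ⟨(bisimCode_succ_eq_iff.1 h).1, fun c => ?_⟩
    constructor
    · rintro ⟨z, hz, rfl⟩
      obtain ⟨z', hz', e⟩ := exists_rel_of_bisimCode_eq h hz
      exact ⟨z', hz', ih e⟩
    · rintro ⟨z, hz, rfl⟩
      obtain ⟨z', hz', e⟩ := exists_rel_of_bisimCode_eq h.symm hz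
      exact ⟨z', hz', ih e⟩

theorem Model.bisimCode_eq_of_le {i j : ℕ} (hij : i ≤ j) {x y : M.World}
    (h : M.bisimCode A j x = M.bisimCode A j y) : M.bisimCode A i x = M.bisimCode A i y := by
  induction j, hij using Nat.le_induction with
  | base => exact h
  | succ j _ ih => exact ih (bisimCode_eq_of_succ h)

theorem Model.forces_iff_of_bisimCode_eq {φ : Formula} : ∀ {j : ℕ} {x y : M.World},
    φ.AtomsBelow A → φ.depth < j → M.bisimCode A j x = M.bisimCode A j y →
      (M.Forces x φ ↔ M.Forces y φ) := by
  induction φ with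
  | atom p =>
    rintro (_ | j) x y hA hd h
    · omega
    · exact (bisimCode_succ_eq_iff.1 h).1 p hA
  | natom p =>
    rintro (_ | j) x y hA hd h
    · omega
    · exact not_congr ((bisimCode_succ_eq_iff.1 h).1 p hA)
  | or φ ψ h1 h2 =>
    intro j x y hA hd h
    simp only [Formula.depth] at hd
    exact or_congr (h1 hA.1 (by omega) h) (h2 hA.2 (by omega) h)
  | and φ ψ h1 h2 =>
    intro j x y hA hd h
    simp only [Formula.depth] at hd
    exact and_congr (h1 hA.1 (by omega) h) (h2 hA.2 (by omega) h)
  | dia φ ih =>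
    rintro (_ | j) x y hA hd h
    · omega
    · simp only [Formula.depth] at hd
      constructor
      · rintro ⟨z, hz, hf⟩
        obtain ⟨z', hz', e⟩ := exists_rel_of_bisimCode_eq h hz
        exact ⟨z', hz', (ih hA (by omega) e).2 hf⟩
      · rintro ⟨z, hz, hf⟩
        obtain ⟨z', hz', e⟩ := exists_rel_of_bisimCode_eq h.symm hz
        exact ⟨z', hz', (ih hA (by omega) e).2 hf⟩
  | box φ ih =>
    rintro (_ | j) x y hA hd h
    · omega
    · simp only [Formula.depth] at hd
      constructor
      · intro hf z hz
        obtain ⟨z', hz', e⟩ := exists_rel_of_bisimCode_eq h.symm hz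
        exact (ih hA (by omega) e).1 (hf z' hz')
      · intro hf z hz
        obtain ⟨z', hz', e⟩ := exists_rel_of_bisimCode_eq h hz
        exact (ih hA (by omega) e).1 (hf z' hz')

end Bisim

/-! ### Layered models and preservation of quasi-density -/

/-- A finite-depth layering of a model: each `a : ι` stands for the world `rep a`, considered at
distance `lvl a ≤ D` from the root, and every world is represented at every distance `i` up to
agreement on formulae of depth less than `D - i`. -/
structure Layering {P : Finset QDP} (M : Model P) (A D : ℕ) (ι : Type) where
  lvl : ι → ℕ
  rep : ι → M.World
  lvl_le : ∀ a, lvl a ≤ D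
  exists_rep : ∀ i ≤ D, ∀ x, ∃ a, lvl a = i ∧ M.bisimCode A (D - i) (rep a) = M.bisimCode A (D - i) x

namespace Layering

variable {P : Finset QDP} {M : Model P} {A D : ℕ} {ι : Type} (S : Layering M A D ι)

/-- Accessibility between the layers: the distance grows by at most one, and successors are
constrained only as far as formulae of the relevant depth can see them. -/
def rel (a b : ι) : Prop :=
  S.lvl b ≤ S.lvl a + 1 ∧ (S.lvl a + 1 < D → ∃ y, M.rel (S.rep a) y ∧
    M.bisimCode A (D - (S.lvl a + 1)) y = M.bisimCode A (D - (S.lvl a + 1)) (S.rep b))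

theorem lvl_le_of_relPow {l : ℕ} : ∀ {a b : ι}, relPow S.rel l a b → S.lvl b ≤ S.lvl a + l := by
  induction l with
  | zero => rintro a b rfl; omega
  | succ l ih =>
    rintro a b ⟨c, hc, hcb⟩
    have := ih hc
    have := hcb.1
    omega

/-- Projects a path to `M`. Levels grow by at most one per step, so each edge is still constrained,
with enough precision to transfer its successor to the world reached so far. -/
theorem exists_relPow_rep {l : ℕ} : ∀ {a b : ι}, relPow S.rel l a b → S.lvl a + l < D →
    ∃ y, relPow M.rel l (S.rep a) y ∧
      M.bisimCode A (D - (S.lvl a + l)) y = M.bisimCode A (D - (S.lvl a + l)) (S.rep b) := by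
  induction l with
  | zero => rintro a b rfl _; exact ⟨_, rfl, rfl⟩
  | succ l ih =>
    rintro a b ⟨c, hc, hcb⟩ hl
    obtain ⟨y, hy, e⟩ := ih hc (by omega)
    have hlc := S.lvl_le_of_relPow hc
    obtain ⟨z, hz, ez⟩ := hcb.2 (by omega)
    rw [show D - (S.lvl a + l) = D - (S.lvl a + (l + 1)) + 1 by omega] at e
    obtain ⟨z', hz', ez'⟩ := Model.exists_rel_of_bisimCode_eq e.symm hz
    exact ⟨z', ⟨y, hy, hz'⟩, ez'.trans (Model.bisimCode_eq_of_le (by omega) ez)⟩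

/-- Lifts a path by climbing one level per step until `D`; each step costs one degree of precision,
exactly what the next level forgets. -/
theorem exists_relPow_of_rep {l : ℕ} (a : ι) : ∀ {y : M.World}, relPow M.rel l (S.rep a) y →
    ∃ b, relPow S.rel l a b ∧ S.lvl b = min (S.lvl a + l) D ∧
      M.bisimCode A (D - (S.lvl a + l)) (S.rep b) = M.bisimCode A (D - (S.lvl a + l)) y := by
  induction l with
  | zero =>
    rintro y rfl
    exact ⟨a, rfl, by have := S.lvl_le a; omega, rfl⟩
  | succ l ih =>
    rintro y ⟨z, hz, hzy⟩
    obtain ⟨c, hc, hlc, e⟩ := ih hz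
    obtain ⟨b, hb, eb⟩ := S.exists_rep (min (S.lvl a + (l + 1)) D) (by omega) y
    refine ⟨b, ⟨c, hc, by omega, fun hlt => ?_⟩, hb, ?_⟩
    · rw [show D - (S.lvl a + l) = D - (S.lvl c + 1) + 1 by omega] at e
      obtain ⟨z', hz', ez'⟩ := Model.exists_rel_of_bisimCode_eq e.symm hzy
      rw [show D - min (S.lvl a + (l + 1)) D = D - (S.lvl c + 1) by omega] at eb
      exact ⟨z', hz', ez'.trans eb.symm⟩
    · exact Model.bisimCode_eq_of_le (by omega) eb

/-- Straightens a path into one that climbs as fast as possible. `holds_rel` needs only the level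
reached; the agreement of codes keeps the induction going. -/
theorem exists_relPow_lvl_eq {l : ℕ} {a : ι} : ∀ {b : ι}, relPow S.rel l a b →
    ∃ c, relPow S.rel l a c ∧ S.lvl c = min (S.lvl a + l) D ∧
      M.bisimCode A (D - (S.lvl a + l)) (S.rep c) =
        M.bisimCode A (D - (S.lvl a + l)) (S.rep b) := by
  induction l with
  | zero =>
    rintro b rfl
    exact ⟨a, rfl, by have := S.lvl_le a; omega, rfl⟩
  | succ l ih =>
    rintro b ⟨d, hd, hdb⟩
    obtain ⟨c, hc, hlc, e⟩ := ih hd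
    have hld := S.lvl_le_of_relPow hd
    obtain ⟨f, hf, ef⟩ := S.exists_rep (min (S.lvl a + (l + 1)) D) (by omega) (S.rep b)
    refine ⟨f, ⟨c, hc, by omega, fun hlt => ?_⟩, hf, ?_⟩
    · obtain ⟨y, hy, ey⟩ := hdb.2 (by omega)
      rw [show D - (S.lvl a + l) = D - (S.lvl c + 1) + 1 by omega] at e
      obtain ⟨z', hz', ez'⟩ := Model.exists_rel_of_bisimCode_eq e.symm hy
      rw [show D - min (S.lvl a + (l + 1)) D = D - (S.lvl c + 1) by omega] at ef
      exact ⟨z', hz', ez'.trans ((Model.bisimCode_eq_of_le (by omega) ey).trans ef.symm)⟩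
    · exact Model.bisimCode_eq_of_le (by omega) ef

theorem relPow_add_of_refl {W : Type} {R : W → W → Prop} {l : ℕ} {a b : W}
    (h : relPow R l a b) (hb : R b b) (m : ℕ) : relPow R (l + m) a b := by
  induction m with
  | zero => exact h
  | succ m ih => exact ⟨b, ih, hb⟩

theorem holds_rel {p : QDP} (hp : p ∈ P) : p.Holds S.rel := by
  obtain ⟨⟨k, n⟩, hk, hkn⟩ := p
  intro a b hab
  simp only at hk hkn hab ⊢
  have hlb := S.lvl_le_of_relPow hab
  -- The last step is split off because lifting reaches only some node similar to the endpoint,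
  -- while the path must end at `b` itself. From here on the longer exponent is `n + 1`.
  obtain ⟨n, rfl⟩ : ∃ m, n = m + 1 := ⟨n - 1, by omega⟩
  by_cases hD : S.lvl a + k < D
  · obtain ⟨y, hy, ey⟩ := S.exists_relPow_rep hab hD
    obtain ⟨z, hz, hzy⟩ := M.holds _ hp _ _ hy
    obtain ⟨c, hc, hlc, ec⟩ := S.exists_relPow_of_rep a hz
    refine ⟨c, hc, by omega, fun hlt => ?_⟩
    rw [show D - (S.lvl a + n) = D - (S.lvl c + 1) + 1 by omega] at ec
    obtain ⟨z', hz', ez'⟩ := Model.exists_rel_of_bisimCode_eq ec.symm hzy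
    exact ⟨z', hz', ez'.trans (Model.bisimCode_eq_of_le (by omega) ey)⟩
  -- Here `c` is at level `D`, so it sees every node, itself included: loop `n - k` times, then step
  -- to `b`.
  · obtain ⟨c, hc, hlc, -⟩ := S.exists_relPow_lvl_eq hab
    have hfree : ∀ d, S.rel c d := fun d =>
      ⟨by have := S.lvl_le d; omega, fun h => by omega⟩
    refine ⟨c, ?_, hfree b⟩
    rw [show n = k + (n - k) by omega]
    exact relPow_add_of_refl hc (hfree c) _

/-- The model on a layering. -/
def toModel [Nonempty ι] : Model P where
  World := ι
  nonempty := inferInstance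
  rel := S.rel
  holds := fun _ hp => S.holds_rel hp
  val := fun p => {a | S.rep a ∈ M.val p}

/-- The depth hypothesis keeps every edge inspected by a modality in the constrained range, with
precision exceeding the depth of the remaining subformula. -/
theorem forces_toModel_iff [Nonempty ι] {φ : Formula} : ∀ {a : ι},
    φ.AtomsBelow A → φ.depth + S.lvl a < D →
      (S.toModel.Forces a φ ↔ M.Forces (S.rep a) φ) := by
  induction φ with
  | atom p => intros; rfl
  | natom p => intros; rfl
  | or φ ψ h1 h2 =>
    intro a hA hd
    simp only [Formula.depth] at hd
    exact or_congr (h1 hA.1 (by omega)) (h2 hA.2 (by omega))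
  | and φ ψ h1 h2 =>
    intro a hA hd
    simp only [Formula.depth] at hd
    exact and_congr (h1 hA.1 (by omega)) (h2 hA.2 (by omega))
  | dia φ ih =>
    intro a hA hd
    simp only [Formula.depth] at hd
    change φ.AtomsBelow A at hA
    constructor
    · rintro ⟨b, hb, hf⟩
      have := hb.1
      obtain ⟨y, hy, e⟩ := hb.2 (by omega)
      refine ⟨y, hy, (Model.forces_iff_of_bisimCode_eq hA (by omega) e).2 ?_⟩
      exact (ih hA (by omega)).1 hf
    · rintro ⟨y, hy, hf⟩
      obtain ⟨b, hb, e⟩ := S.exists_rep (S.lvl a + 1) (by omega) y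
      refine ⟨b, ⟨hb.le, fun _ => ⟨y, hy, e.symm⟩⟩, (ih hA (by omega)).2 ?_⟩
      exact (Model.forces_iff_of_bisimCode_eq hA (by omega) e).2 hf
  | box φ ih =>
    intro a hA hd
    simp only [Formula.depth] at hd
    change φ.AtomsBelow A at hA
    constructor
    · intro hf y hy
      obtain ⟨b, hb, e⟩ := S.exists_rep (S.lvl a + 1) (by omega) y
      refine (Model.forces_iff_of_bisimCode_eq hA (by omega) e).1 ?_
      exact (ih hA (by omega)).1 (hf b ⟨hb.le, fun _ => ⟨y, hy, e.symm⟩⟩)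
    · intro hf b hb
      have := hb.1
      obtain ⟨y, hy, e⟩ := hb.2 (by omega)
      refine (ih hA (by omega)).2 ?_
      exact (Model.forces_iff_of_bisimCode_eq hA (by omega) e).1 (hf y hy)

end Layering

/-! ### Finite countermodels of bounded size -/

/-- The number of worlds that suffices to refute a non-theorem of depth less than `D` over the
atoms below `A`. -/
def worldBound (A D : ℕ) : ℕ := (D + 1) * bisimBound A D

open Classical in
/-- The layering of a model indexed by pairs of a distance and a bisimulation code. -/
noncomputable def Model.layering {P : Finset QDP} (M : Model P) (A D : ℕ) :
    Layering M A D (Fin (worldBound A D)) where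
  lvl a := a / bisimBound A D
  rep a :=
    -- The quotient is the level and the remainder the code. An unrealised code gets an arbitrary
    -- world: superfluous representatives are harmless.
    if h : ∃ x, M.bisimCode A (D - a / bisimBound A D) x = a % bisimBound A D then h.choose
    else M.nonempty.some
  lvl_le a := Nat.lt_succ_iff.1 (Nat.div_lt_of_lt_mul (by
    rw [Nat.mul_comm]
    exact a.2))
  exists_rep i hi x := by
    have hlt : M.bisimCode A (D - i) x < bisimBound A D :=
      (M.bisimCode_lt A _ x).trans_le (bisimBound_mono A (Nat.sub_le D i))
    have hdiv : (bisimBound A D * i + M.bisimCode A (D - i) x) / bisimBound A D = i := by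
      rw [Nat.mul_add_div (bisimBound_pos A D), Nat.div_eq_of_lt hlt, Nat.add_zero]
    have hmod : (bisimBound A D * i + M.bisimCode A (D - i) x) % bisimBound A D =
        M.bisimCode A (D - i) x := by
      rw [Nat.mul_add_mod, Nat.mod_eq_of_lt hlt]
    have hN : bisimBound A D * i + M.bisimCode A (D - i) x < worldBound A D := by
      have := Nat.mul_le_mul_left (bisimBound A D) (Nat.succ_le_succ hi)
      rw [worldBound, Nat.mul_comm (D + 1)]
      simp only [Nat.mul_succ] at this ⊢
      omega
    refine ⟨⟨_, hN⟩, hdiv, ?_⟩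
    simp only [hdiv, hmod]
    have hex : ∃ y, M.bisimCode A (D - i) y = M.bisimCode A (D - i) x := ⟨x, rfl⟩
    rw [dif_pos hex]
    exact hex.choose_spec

theorem worldBound_pos (A D : ℕ) : 0 < worldBound A D :=
  Nat.mul_pos D.succ_pos (bisimBound_pos A D)

/-- Every non-theorem is refuted in a model with a prescribed finite number of worlds. -/
theorem exists_fin_model_not_forces {P : Finset QDP} {φ : Formula} (h : φ ∉ Logic P) {A D : ℕ}
    (hA : φ.AtomsBelow A) (hD : φ.depth < D) :
    ∃ (R : Fin (worldBound A D) → Fin (worldBound A D) → Prop)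
      (hR : ∀ p ∈ P, p.Holds R) (V : ℕ → Set (Fin (worldBound A D)))
      (w : Fin (worldBound A D)),
      ¬ Model.Forces (P := P) ⟨⟨_, ⟨w⟩, R, hR⟩, V⟩ w φ := by
  simp only [Logic, Set.mem_ofPred_eq, not_forall] at h
  obtain ⟨M, x, hx⟩ := h
  have : Nonempty (Fin (worldBound A D)) := ⟨⟨0, worldBound_pos A D⟩⟩
  obtain ⟨a, ha, e⟩ := (M.layering A D).exists_rep 0 (Nat.zero_le D) x
  refine ⟨_, fun p hp => (M.layering A D).holds_rel hp, (M.layering A D).toModel.val, a, ?_⟩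
  intro hf
  exact hx ((Model.forces_iff_of_bisimCode_eq hA hD e).1
    (((M.layering A D).forces_toModel_iff hA (by omega)).1 hf))

/-! ### Primitive recursive tools -/

section PrimrecQuantifiers

variable {α β : Type} [Primcodable α] [Primcodable β]

theorem primrecPred_exists_mem {f : β → List α} (hf : Primrec f) {p : β → α → Prop}
    (hp : PrimrecPred fun x : α × β => p x.2 x.1) : PrimrecPred fun b => ∃ a ∈ f b, p b a :=
  (PrimrecRel.exists_mem_list (R := fun a b => p b a) hp).comp hf Primrec.id

theorem primrecPred_forall_mem {f : β → List α} (hf : Primrec f) {p : β → α → Prop}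
    (hp : PrimrecPred fun x : α × β => p x.2 x.1) : PrimrecPred fun b => ∀ a ∈ f b, p b a :=
  (PrimrecRel.forall_mem_list (R := fun a b => p b a) hp).comp hf Primrec.id

theorem primrec_filter {f : β → List α} (hf : Primrec f) {p : β → α → Prop}
    [∀ b, DecidablePred (p b)]
    (hp : PrimrecPred fun x : α × β => p x.2 x.1) :
    Primrec fun b => (f b).filter fun a => p b a :=
  (PrimrecRel.listFilter (R := fun a b => p b a) hp).comp hf Primrec.id

theorem primrecRel_mem : PrimrecRel fun (a : α) (L : List α) => a ∈ L :=
  (primrecPred_exists_mem (f := fun x : α × List α => x.2) (p := fun x a => a = x.1) Primrec.snd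
    (Primrec.eq.comp Primrec.fst (Primrec.fst.comp Primrec.snd))).of_eq fun x => by simp

theorem primrec_pow : Primrec₂ fun a b : ℕ => a ^ b :=
  Primrec₂.unpaired'.1 Nat.Primrec.pow

theorem primrecRel_testBit : PrimrecRel fun r i : ℕ => r.testBit i = true := by
  refine PrimrecPred.of_eq (p := fun x : ℕ × ℕ => x.1 / 2 ^ x.2 % 2 = 1)
    (Primrec.eq.comp (Primrec.nat_mod.comp (Primrec.nat_div.comp Primrec.fst
      (primrec_pow.comp (Primrec.const 2) Primrec.snd)) (Primrec.const 2)) (Primrec.const 1))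
    fun x => ?_
  simp [Nat.testBit_eq_decide_div_mod_eq]

end PrimrecQuantifiers

/-! ### Finite models as bit masks and their evaluation -/

/-- A Kripke model on the numbers below `size`, with accessibility and valuation as bit masks. -/
structure BitModel where
  size : ℕ
  rel : ℕ
  val : ℕ

namespace BitModel

/-- Bit models as triples of numbers. -/
def equivProd : BitModel ≃ ℕ × ℕ × ℕ where
  toFun B := (B.size, B.rel, B.val)
  invFun x := ⟨x.1, x.2.1, x.2.2⟩
  left_inv _ := rfl
  right_inv _ := rfl

instance : Primcodable BitModel := Primcodable.ofEquiv _ equivProd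

theorem primrec_toProd : Primrec equivProd := Primrec.of_equiv

theorem primrec_size : Primrec size := Primrec.fst.comp primrec_toProd

theorem primrec_rel : Primrec rel := (Primrec.fst.comp Primrec.snd).comp primrec_toProd

theorem primrec_val : Primrec val := (Primrec.snd.comp Primrec.snd).comp primrec_toProd

theorem primrec_mk {α : Type} [Primcodable α] {f g h : α → ℕ} (hf : Primrec f) (hg : Primrec g)
    (hh : Primrec h) : Primrec fun a => (⟨f a, g a, h a⟩ : BitModel) :=
  (Primrec.of_equiv_symm (e := equivProd)).comp (hf.pair (hg.pair hh))

/-- The accessibility relation of a bit model. -/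
def Adj (B : BitModel) (x y : ℕ) : Prop := B.rel.testBit (Nat.pair x y) = true

/-- Truth of atoms in a bit model. -/
def Val (B : BitModel) (p x : ℕ) : Prop := B.val.testBit (Nat.pair p x) = true

instance (B : BitModel) (x y : ℕ) : Decidable (B.Adj x y) := inferInstanceAs (Decidable (_ = true))

instance (B : BitModel) (p x : ℕ) : Decidable (B.Val p x) := inferInstanceAs (Decidable (_ = true))

section

variable {α : Type} [Primcodable α] {b : α → BitModel} {f g : α → ℕ}

theorem primrecPred_adj (hb : Primrec b) (hf : Primrec f) (hg : Primrec g) :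
    PrimrecPred fun a => (b a).Adj (f a) (g a) :=
  primrecRel_testBit.comp (primrec_rel.comp hb) (Primrec₂.natPair.comp hf hg)

theorem primrecPred_val (hb : Primrec b) (hf : Primrec f) (hg : Primrec g) :
    PrimrecPred fun a => (b a).Val (f a) (g a) :=
  primrecRel_testBit.comp (primrec_val.comp hb) (Primrec₂.natPair.comp hf hg)

end

/-- The worlds reachable from `x` in exactly `l` steps. -/
def reach (B : BitModel) (x : ℕ) : ℕ → List ℕ
  | 0 => [x]
  | l + 1 => (List.range B.size).filter fun z => ∃ y ∈ B.reach x l, B.Adj y z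

theorem primrec_reach : Primrec fun t : (BitModel × ℕ) × ℕ => t.1.1.reach t.1.2 t.2 := by
  have h : Primrec₂ fun (t : BitModel × ℕ) (s : ℕ × List ℕ) =>
      (List.range t.1.size).filter fun z => ∃ y ∈ s.2, t.1.Adj y z := by
    refine primrec_filter
      (f := fun u : (BitModel × ℕ) × (ℕ × List ℕ) => List.range u.1.1.size)
      (p := fun u z => ∃ y ∈ u.2.2, u.1.1.Adj y z)
      (Primrec.list_range.comp (primrec_size.comp (Primrec.fst.comp Primrec.fst))) ?_
    refine primrecPred_exists_mem
      (f := fun x : ℕ × ((BitModel × ℕ) × (ℕ × List ℕ)) => x.2.2.2)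
      (p := fun x y => x.2.1.1.Adj y x.1)
      (Primrec.snd.comp (Primrec.snd.comp Primrec.snd)) ?_
    exact primrecPred_adj
      (Primrec.fst.comp (Primrec.fst.comp (Primrec.snd.comp Primrec.snd))) Primrec.fst
      (Primrec.fst.comp Primrec.snd)
  have := Primrec.nat_rec (f := fun t : BitModel × ℕ => [t.2])
    (Primrec.list_cons.comp Primrec.snd (Primrec.const [])) h
  change Primrec₂ fun (t : BitModel × ℕ) l => t.1.reach t.2 l
  refine this.of_eq fun t l => ?_
  induction l with
  | zero => rfl
  | succ l ih =>
    simp only at ih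
    simp only [reach, ← ih]

/-- The quasi-density property `p` in a bit model. -/
def Satisfies (B : BitModel) (p : QDP) : Prop :=
  ∀ x ∈ List.range B.size, ∀ y ∈ B.reach x p.1.1, y ∈ B.reach x p.1.2

theorem primrecRel_satisfies : PrimrecRel Satisfies := by
  have hreach {α : Type} [Primcodable α] {b : α → BitModel} {f g : α → ℕ} (hb : Primrec b)
      (hf : Primrec f) (hg : Primrec g) : Primrec fun a => (b a).reach (f a) (g a) :=
    primrec_reach.comp ((hb.pair hf).pair hg)
  have hp : Primrec fun p : QDP => p.1 := Primrec.subtype_val (hp := primrecPred_qdp)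
  refine primrecPred_forall_mem (f := fun t : BitModel × QDP => List.range t.1.size)
    (p := fun t x => ∀ y ∈ t.1.reach x t.2.1.1, y ∈ t.1.reach x t.2.1.2)
    (Primrec.list_range.comp (primrec_size.comp Primrec.fst)) ?_
  refine primrecPred_forall_mem
    (f := fun u : ℕ × (BitModel × QDP) => u.2.1.reach u.1 u.2.2.1.1)
    (p := fun u y => y ∈ u.2.1.reach u.1 u.2.2.1.2)
    (hreach (Primrec.fst.comp Primrec.snd) Primrec.fst
      (Primrec.fst.comp (hp.comp (Primrec.snd.comp Primrec.snd)))) ?_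
  exact primrecRel_mem.comp Primrec.fst
    (hreach (Primrec.fst.comp (Primrec.snd.comp Primrec.snd)) (Primrec.fst.comp Primrec.snd)
      (Primrec.snd.comp (hp.comp (Primrec.snd.comp (Primrec.snd.comp Primrec.snd)))))

/-- Forcing in a bit model. -/
def Forces (B : BitModel) : ℕ → Formula → Prop
  | w, .atom p => B.Val p w
  | w, .natom p => ¬ B.Val p w
  | w, .or φ ψ => B.Forces w φ ∨ B.Forces w ψ
  | w, .and φ ψ => B.Forces w φ ∧ B.Forces w ψ
  | w, .dia φ => ∃ u ∈ List.range B.size, B.Adj w u ∧ B.Forces u φ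
  | w, .box φ => ∀ u ∈ List.range B.size, B.Adj w u → B.Forces u φ

open Classical in
/-- The list of worlds of a bit model forcing a formula. -/
noncomputable def extension (B : BitModel) (φ : Formula) : List ℕ :=
  (List.range B.size).filter fun w => B.Forces w φ

theorem mem_extension {B : BitModel} {φ : Formula} {w : ℕ} :
    w ∈ B.extension φ ↔ w < B.size ∧ B.Forces w φ := by
  simp [extension]

/-- The forcing condition for the formula with code `L.length`, where `L` lists the extensions
of the formulae with smaller codes. -/
def ForcesStep (B : BitModel) (L : List (List ℕ)) (w : ℕ) : Prop :=
  (L.length % 6 = 0 ∧ B.Val (L.length / 6) w) ∨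
  (L.length % 6 = 1 ∧ ¬ B.Val (L.length / 6) w) ∨
  -- The default `[]` is never read under a matching tag: the tags `2` to `5` force a positive
  -- length, and all indices are then smaller than it.
  (L.length % 6 = 2 ∧ (w ∈ L.getD (L.length / 6).unpair.1 [] ∨
    w ∈ L.getD (L.length / 6).unpair.2 [])) ∨
  (L.length % 6 = 3 ∧ (w ∈ L.getD (L.length / 6).unpair.1 [] ∧
    w ∈ L.getD (L.length / 6).unpair.2 [])) ∨
  (L.length % 6 = 4 ∧ ∃ u ∈ L.getD (L.length / 6) [], B.Adj w u) ∨
  (L.length % 6 = 5 ∧ ∀ u ∈ List.range B.size, ¬ B.Adj w u ∨ u ∈ L.getD (L.length / 6) [])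

theorem primrecPred_forcesStep :
    PrimrecPred fun t : ℕ × (BitModel × List (List ℕ)) => ForcesStep t.2.1 t.2.2 t.1 := by
  have hL : Primrec fun t : ℕ × (BitModel × List (List ℕ)) => t.2.2 :=
    Primrec.snd.comp Primrec.snd
  have hB : Primrec fun t : ℕ × (BitModel × List (List ℕ)) => t.2.1 :=
    Primrec.fst.comp Primrec.snd
  have hlen := Primrec.list_length.comp hL
  have hdiv := Primrec.nat_div.comp hlen (Primrec.const 6)
  have hmod (i : ℕ) := Primrec.eq.comp (Primrec.nat_mod.comp hlen (Primrec.const 6))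
    (Primrec.const i)
  have hget {f : ℕ × (BitModel × List (List ℕ)) → ℕ} (hf : Primrec f) :
      Primrec fun t : ℕ × (BitModel × List (List ℕ)) => t.2.2.getD (f t) [] := (Primrec.list_getD []).comp hL hf
  have hl := hget (Primrec.fst.comp (Primrec.unpair.comp hdiv))
  have hr := hget (Primrec.snd.comp (Primrec.unpair.comp hdiv))
  have hval := primrecPred_val hB hdiv Primrec.fst
  have hml := primrecRel_mem.comp Primrec.fst hl
  have hmr := primrecRel_mem.comp Primrec.fst hr
  have hadj : PrimrecPred fun s : ℕ × (ℕ × (BitModel × List (List ℕ))) =>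
      s.2.2.1.Adj s.2.1 s.1 :=
    primrecPred_adj (hB.comp Primrec.snd) (Primrec.fst.comp Primrec.snd) Primrec.fst
  have hdia : PrimrecPred fun t : ℕ × (BitModel × List (List ℕ)) =>
      ∃ u ∈ t.2.2.getD (t.2.2.length / 6) [], t.2.1.Adj t.1 u :=
    primrecPred_exists_mem (hget hdiv) hadj
  have hbox : PrimrecPred fun t : ℕ × (BitModel × List (List ℕ)) =>
      ∀ u ∈ List.range t.2.1.size, ¬ t.2.1.Adj t.1 u ∨ u ∈ t.2.2.getD (t.2.2.length / 6) [] :=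
    primrecPred_forall_mem
      (p := fun t u => ¬ t.2.1.Adj t.1 u ∨ u ∈ t.2.2.getD (t.2.2.length / 6) [])
      (Primrec.list_range.comp (primrec_size.comp hB))
      (hadj.not.or (primrecRel_mem.comp Primrec.fst ((hget hdiv).comp Primrec.snd)))
  exact ((hmod 0).and hval).or (((hmod 1).and hval.not).or (((hmod 2).and (hml.or hmr)).or
    (((hmod 3).and (hml.and hmr)).or (((hmod 4).and hdia).or ((hmod 5).and hbox)))))

end BitModel

/-- Formulae are numbered by their codes. -/
noncomputable def Formula.codeEquiv : Formula ≃ ℕ :=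
  Equiv.ofBijective Formula.code ⟨Formula.code_injective, Formula.code_surjective⟩

theorem Formula.primrec_code : Primrec Formula.code :=
  Primrec.of_equiv (e := Formula.codeEquiv)

namespace BitModel

theorem forcesStep_iff (B : BitModel) (φ : Formula) {w : ℕ} (hw : w < B.size) :
    B.ForcesStep ((List.range φ.code).map fun n => B.extension (Formula.codeEquiv.symm n)) w ↔
      B.Forces w φ := by
  have hget (ψ : Formula) (h : ψ.code < φ.code) :
      ((List.range φ.code).map fun n => B.extension (Formula.codeEquiv.symm n)).getD ψ.code [] =
        B.extension ψ := by
    have : Formula.codeEquiv.symm ψ.code = ψ := Formula.codeEquiv.symm_apply_apply ψ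
    simp [List.getD_eq_getElem?_getD, h, this]
  unfold ForcesStep
  simp only [List.length_map, List.length_range]
  cases φ with
  | atom p =>
    have h1 : (Formula.atom p).code % 6 = 0 := by simp only [Formula.code]; omega
    have h2 : (Formula.atom p).code / 6 = p := by simp only [Formula.code]; omega
    simp [h1, h2, Forces]
  | natom p =>
    have h1 : (Formula.natom p).code % 6 = 1 := by simp only [Formula.code]; omega
    have h2 : (Formula.natom p).code / 6 = p := by simp only [Formula.code]; omega
    simp [h1, h2, Forces]
  | or φ ψ =>
    have hl := Nat.left_le_pair φ.code ψ.code
    have hr := Nat.right_le_pair φ.code ψ.code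
    have h1 : (Formula.or φ ψ).code % 6 = 2 := by simp only [Formula.code]; omega
    have h2 : (Formula.or φ ψ).code / 6 = Nat.pair φ.code ψ.code := by
      simp only [Formula.code]; omega
    have h3 := hget φ (by simp only [Formula.code]; omega)
    have h4 := hget ψ (by simp only [Formula.code]; omega)
    simp only [h1, h2, Nat.unpair_pair, h3, h4, mem_extension, Forces, hw]
    simp
  | and φ ψ =>
    have hl := Nat.left_le_pair φ.code ψ.code
    have hr := Nat.right_le_pair φ.code ψ.code
    have h1 : (Formula.and φ ψ).code % 6 = 3 := by simp only [Formula.code]; omega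
    have h2 : (Formula.and φ ψ).code / 6 = Nat.pair φ.code ψ.code := by
      simp only [Formula.code]; omega
    have h3 := hget φ (by simp only [Formula.code]; omega)
    have h4 := hget ψ (by simp only [Formula.code]; omega)
    simp only [h1, h2, Nat.unpair_pair, h3, h4, mem_extension, Forces, hw]
    simp
  | dia φ =>
    have h1 : (Formula.dia φ).code % 6 = 4 := by simp only [Formula.code]; omega
    have h2 : (Formula.dia φ).code / 6 = φ.code := by simp only [Formula.code]; omega
    have h3 := hget φ (by simp only [Formula.code]; omega)
    simp only [h1, h2, h3, mem_extension, Forces, List.mem_range]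
    simp [and_comm, and_left_comm]
  | box φ =>
    have h1 : (Formula.box φ).code % 6 = 5 := by simp only [Formula.code]; omega
    have h2 : (Formula.box φ).code / 6 = φ.code := by simp only [Formula.code]; omega
    have h3 := hget φ (by simp only [Formula.code]; omega)
    simp only [h1, h2, h3, mem_extension, Forces, List.mem_range]
    simp +contextual [imp_iff_not_or]

/-- Structural recursion becomes course-of-values recursion on codes. Whole extensions are tabulated
because modal clauses consult other worlds. -/
theorem primrec_extension : Primrec₂ extension := by
  classical
  have h : Primrec₂ fun (B : BitModel) (n : ℕ) => B.extension (Formula.codeEquiv.symm n) := by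
    refine Primrec.nat_strong_rec _
      (g := fun B L => some ((List.range B.size).filter fun w => B.ForcesStep L w)) ?_ ?_
    · exact Primrec.option_some.comp (primrec_filter
        (p := fun (t : BitModel × List (List ℕ)) w => t.1.ForcesStep t.2 w)
        (Primrec.list_range.comp (primrec_size.comp Primrec.fst)) primrecPred_forcesStep)
    · intro B n
      obtain ⟨φ, rfl⟩ := Formula.codeEquiv.surjective n
      rw [Formula.codeEquiv.symm_apply_apply]
      refine congrArg some (List.filter_congr fun w hw => ?_)
      exact decide_eq_decide.2 (B.forcesStep_iff φ (List.mem_range.1 hw))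
  refine (h.comp Primrec.fst (Formula.primrec_code.comp Primrec.snd)).of_eq fun t => ?_
  exact congrArg t.1.extension (Formula.codeEquiv.symm_apply_apply t.2)

/-! ### Correctness of bit models -/

/-- The bit model describes the relation `R` on `Fin size`. -/
def Represents (B : BitModel) (R : Fin B.size → Fin B.size → Prop) : Prop :=
  ∀ a b : Fin B.size, B.Adj a b ↔ R a b

section Represents

variable {B : BitModel} {R : Fin B.size → Fin B.size → Prop}

theorem mem_reach_iff (h : B.Represents R) {l : ℕ} (a : Fin B.size) :
    ∀ {y : ℕ}, y ∈ B.reach a l ↔ ∃ b : Fin B.size, b = y ∧ relPow R l a b := by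
  induction l with
  | zero => intro y; simp [reach, relPow, eq_comm]
  | succ l ih =>
    intro y
    simp only [reach, List.mem_filter, List.mem_range, decide_eq_true_eq, ih, relPow]
    constructor
    · rintro ⟨hy, _, ⟨c, rfl, hc⟩, hcy⟩
      exact ⟨⟨y, hy⟩, rfl, c, hc, (h c ⟨y, hy⟩).1 hcy⟩
    · rintro ⟨b, rfl, c, hc, hcb⟩
      exact ⟨b.2, c, ⟨c, rfl, hc⟩, (h c b).2 hcb⟩

theorem satisfies_iff (h : B.Represents R) (p : QDP) : B.Satisfies p ↔ p.Holds R := by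
  constructor
  · intro hs a b hab
    obtain ⟨c, hc, hac⟩ := (mem_reach_iff h a).1
      (hs a (List.mem_range.2 a.2) b ((mem_reach_iff h a).2 ⟨b, rfl, hab⟩))
    rwa [Fin.ext hc] at hac
  · intro hp x hx y hy
    obtain ⟨b, hb, hab⟩ := (mem_reach_iff h ⟨x, List.mem_range.1 hx⟩).1 hy
    exact (mem_reach_iff h ⟨x, List.mem_range.1 hx⟩).2 ⟨b, hb, hp _ _ hab⟩

/-- Valuations are compared only on atoms below `A`, since a finite mask cannot record an arbitrary
valuation of all atoms. -/
theorem forces_iff {P : Finset QDP} (h : B.Represents R) (hne : Nonempty (Fin B.size))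
    (hR : ∀ p ∈ P, p.Holds R) {V : ℕ → Set (Fin B.size)} {A : ℕ}
    (hV : ∀ p < A, ∀ a : Fin B.size, B.Val p a ↔ a ∈ V p) {φ : Formula} :
    ∀ a : Fin B.size, φ.AtomsBelow A →
      (B.Forces a φ ↔ Model.Forces (P := P) ⟨⟨_, hne, R, hR⟩, V⟩ a φ) := by
  induction φ with
  | atom p => exact fun a hA => hV p hA a
  | natom p => exact fun a hA => not_congr (hV p hA a)
  | or φ ψ h1 h2 => exact fun a hA => or_congr (h1 a hA.1) (h2 a hA.2)
  | and φ ψ h1 h2 => exact fun a hA => and_congr (h1 a hA.1) (h2 a hA.2)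
  | dia φ ih =>
    intro a hA
    constructor
    · rintro ⟨u, hu, hau, hf⟩
      exact ⟨⟨u, List.mem_range.1 hu⟩, (h _ _).1 hau, (ih _ hA).1 hf⟩
    · rintro ⟨u, hau, hf⟩
      exact ⟨u, List.mem_range.2 u.2, (h a u).2 hau, (ih _ hA).2 hf⟩
  | box φ ih =>
    intro a hA
    constructor
    · intro hf u hau
      exact (ih u hA).1 (hf u (List.mem_range.2 u.2) ((h a u).2 hau))
    · intro hf u hu hau
      exact (ih ⟨u, List.mem_range.1 hu⟩ hA).2 (hf _ ((h _ _).1 hau))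

end Represents

end BitModel

/-! ### The bounded search and its primitive recursiveness -/

theorem exists_testBit_iff (K : ℕ) (q : ℕ → Prop) :
    ∃ r < 2 ^ K, ∀ i < K, r.testBit i = true ↔ q i := by
  classical
  refine ⟨Nat.ofBits fun i : Fin K => decide (q i), Nat.ofBits_lt_two_pow _, fun i hi => ?_⟩
  rw [Nat.testBit_ofBits_lt _ _ hi]
  simp

/-- A bound on the number of worlds of countermodels of the formula with code `c`. -/
def counterSize (c : ℕ) : ℕ := worldBound (c + 1) (c + 1)

/-- A bound on the bit masks describing countermodels of the formula with code `c`. -/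
def maskBound (c : ℕ) : ℕ := 2 ^ (counterSize c + c + 2) ^ 2

/-- Pairs with entries at most `N` have codes below `(N + 1) ^ 2`. Taking `N = counterSize c + c`
covers both world-world and atom-world pairs, so one bound serves both masks. -/
theorem exists_mask (c : ℕ) (q : ℕ → ℕ → Prop) : ∃ r < maskBound c,
    ∀ i j, i ≤ counterSize c + c → j ≤ counterSize c + c →
      (r.testBit (Nat.pair i j) = true ↔ q i j) := by
  obtain ⟨r, hr, h⟩ := exists_testBit_iff ((counterSize c + c + 2) ^ 2)
    fun n => q n.unpair.1 n.unpair.2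
  refine ⟨r, hr, fun i j hi hj => ?_⟩
  rw [h, Nat.unpair_pair]
  exact (Nat.pair_lt_max_add_one_sq i j).trans_le (Nat.pow_le_pow_left (by omega) 2)

theorem not_mem_logic_iff (P : List QDP) (φ : Formula) :
    φ ∉ Logic P.toFinset ↔
      ∃ r ∈ List.range (maskBound φ.code), ∃ v ∈ List.range (maskBound φ.code),
        (∀ p ∈ P, BitModel.Satisfies ⟨counterSize φ.code, r, v⟩ p) ∧
        ∃ w ∈ List.range (counterSize φ.code),
          w ∉ BitModel.extension ⟨counterSize φ.code, r, v⟩ φ := by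
  have hA : φ.AtomsBelow (φ.code + 1) := Formula.atomsBelow_of_code_lt φ.code.lt_succ_self
  constructor
  · intro h
    obtain ⟨R, hR, V, w, hw⟩ := exists_fin_model_not_forces h hA
      (Nat.lt_succ_of_le φ.depth_le_code)
    obtain ⟨r, hr, hrel⟩ := exists_mask φ.code
      fun i j => ∃ (hi : i < counterSize φ.code) (hj : j < counterSize φ.code), R ⟨i, hi⟩ ⟨j, hj⟩
    obtain ⟨v, hv, hval⟩ := exists_mask φ.code
      fun p i => ∃ hi : i < counterSize φ.code, ⟨i, hi⟩ ∈ V p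
    have hrep : BitModel.Represents ⟨counterSize φ.code, r, v⟩ R := fun a b => by
      refine (hrel a b (by have := a.2; simp only at this; omega)
        (by have := b.2; simp only at this; omega)).trans ?_
      exact ⟨fun ⟨_, _, h⟩ => h, fun h => ⟨a.2, b.2, h⟩⟩
    refine ⟨r, List.mem_range.2 hr, v, List.mem_range.2 hv, fun p hp => ?_, w,
      List.mem_range.2 w.2, fun hmem => hw ?_⟩
    · exact (BitModel.satisfies_iff hrep p).2 (hR p (List.mem_toFinset.2 hp))
    · refine (BitModel.forces_iff (A := φ.code + 1) hrep ⟨w⟩ hR (fun p hp a => ?_) w hA).1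
        (BitModel.mem_extension.1 hmem).2
      refine (hval p a (by omega) (by have := a.2; simp only at this; omega)).trans ?_
      exact ⟨fun ⟨_, h⟩ => h, fun h => ⟨a.2, h⟩⟩
  -- Conversely, a bit model passing the checks is itself a model over `P`, and it refutes `φ` at
  -- `w`.
  · rintro ⟨r, -, v, -, hP, w, hw, hf⟩ hmem
    rw [List.mem_range] at hw
    let B : BitModel := ⟨counterSize φ.code, r, v⟩
    have hrep : B.Represents fun a b => B.Adj a b := fun _ _ => Iff.rfl
    refine hf (BitModel.mem_extension.2 ⟨hw, ?_⟩)
    refine (BitModel.forces_iff (P := P.toFinset) (V := fun p => {a | B.Val p a}) hrep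
      ⟨⟨w, hw⟩⟩ (fun p hp => ?_) (fun _ _ _ => Iff.rfl) ⟨w, hw⟩ hA).2 (hmem _ _)
    exact (BitModel.satisfies_iff hrep p).1 (hP p (List.mem_toFinset.1 hp))

theorem primrec_counterSize : Primrec counterSize := by
  have hb : Primrec₂ bisimBound := by
    have := Primrec.nat_rec (f := fun _ : ℕ => 1) (g := fun A s => 2 ^ (A + s.2))
      (Primrec.const 1) (primrec_pow.comp (Primrec.const 2)
        (Primrec.nat_add.comp Primrec.fst (Primrec.snd.comp Primrec.snd)))
    refine this.of_eq fun A j => ?_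
    induction j with
    | zero => rfl
    | succ j ih =>
      simp only at ih
      simp only [bisimBound, ← ih]
  exact Primrec.nat_mul.comp (Primrec.succ.comp Primrec.succ) (hb.comp Primrec.succ Primrec.succ)

theorem primrec_maskBound : Primrec maskBound :=
  primrec_pow.comp (Primrec.const 2) (primrec_pow.comp
    (Primrec.succ.comp (Primrec.succ.comp (Primrec.nat_add.comp primrec_counterSize Primrec.id)))
    (Primrec.const 2))

theorem primrecPred_mem_logic :
    PrimrecPred fun x : List QDP × Formula => x.2 ∈ Logic x.1.toFinset := by
  have hc : Primrec fun x : List QDP × Formula => x.2.code :=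
    Formula.primrec_code.comp Primrec.snd
  have hmask := Primrec.list_range.comp (primrec_maskBound.comp hc)
  have hsize := primrec_counterSize.comp hc
  let S := ℕ × (ℕ × (List QDP × Formula))
  have hS : Primrec fun t : S => t.2.2 := Primrec.snd.comp Primrec.snd
  have hB : Primrec fun t : S => (⟨counterSize t.2.2.2.code, t.2.1, t.1⟩ : BitModel) :=
    BitModel.primrec_mk (hsize.comp hS) (Primrec.fst.comp Primrec.snd) Primrec.fst
  have hcheck : PrimrecPred fun t : S =>
      ∀ p ∈ t.2.2.1, BitModel.Satisfies ⟨counterSize t.2.2.2.code, t.2.1, t.1⟩ p :=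
    primrecPred_forall_mem (Primrec.fst.comp hS)
      (BitModel.primrecRel_satisfies.comp (hB.comp Primrec.snd) Primrec.fst)
  have hrefute : PrimrecPred fun t : S => ∃ w ∈ List.range (counterSize t.2.2.2.code),
      w ∉ BitModel.extension ⟨counterSize t.2.2.2.code, t.2.1, t.1⟩ t.2.2.2 :=
    primrecPred_exists_mem (Primrec.list_range.comp (hsize.comp hS))
      (primrecRel_mem.comp Primrec.fst (BitModel.primrec_extension.comp (hB.comp Primrec.snd)
        (Primrec.snd.comp (hS.comp Primrec.snd)))).not
  have hval : PrimrecPred fun t : ℕ × (List QDP × Formula) =>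
      ∃ v ∈ List.range (maskBound t.2.2.code),
        (∀ p ∈ t.2.1, BitModel.Satisfies ⟨counterSize t.2.2.code, t.1, v⟩ p) ∧
        ∃ w ∈ List.range (counterSize t.2.2.code),
          w ∉ BitModel.extension ⟨counterSize t.2.2.code, t.1, v⟩ t.2.2 :=
    primrecPred_exists_mem (hmask.comp Primrec.snd) (hcheck.and hrefute)
  have hrel : PrimrecPred fun x : List QDP × Formula =>
      ∃ r ∈ List.range (maskBound x.2.code), ∃ v ∈ List.range (maskBound x.2.code),
        (∀ p ∈ x.1, BitModel.Satisfies ⟨counterSize x.2.code, r, v⟩ p) ∧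
        ∃ w ∈ List.range (counterSize x.2.code),
          w ∉ BitModel.extension ⟨counterSize x.2.code, r, v⟩ x.2 :=
    primrecPred_exists_mem hmask hval
  refine hrel.not.of_eq fun x => ?_
  rw [← not_mem_logic_iff, not_not]

end QuasiDense

/-- Every logic `L(P)` is decidable, and decidable uniformly: one algorithm works for all
finite sets `P` (given as a list of pairs of exponents) and all formulae. -/
theorem theorem2p3 :
    (∀ P : Finset QuasiDense.QDP,
      ComputablePred fun φ : QuasiDense.Formula => φ ∈ QuasiDense.Logic P) ∧
    ComputablePred fun x : List QuasiDense.QDP × QuasiDense.Formula =>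
      x.2 ∈ QuasiDense.Logic x.1.toFinset := by
  refine ⟨fun P => ?_, ?_⟩
  -- For fixed `P`, the uniform procedure is run on the constant list `P.toList`.
  · obtain ⟨_, h⟩ := (QuasiDense.primrecPred_mem_logic.comp
      ((Primrec.const P.toList).pair Primrec.id)).of_eq
      (q := fun φ : QuasiDense.Formula => φ ∈ QuasiDense.Logic P) fun φ => by simp
    exact ⟨_, h.to_comp⟩
  · obtain ⟨_, h⟩ := QuasiDense.primrecPred_mem_logic
    exact ⟨_, h.to_comp⟩
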